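/- **Class $\mathbb M$ chains.** Let $M,j_0$ be nonnegative integers and $\mathcal N$ a finite set. A class $\mathbb M$ Markov chain is an ergodic (i.e. irreducible and positive recurrent) continuous time Markov chain with state space $\mathcal N\sqcup\mathcal R$, $\mathcal R=\{(m,j):0\le m\le M,\ j\ge j_0\}$ ($m$ is the phase and $j$ the level), whose transition rates $q(x,y)$, $x\ne y$, are as follows. Rates between states of $\mathcal N$, from states of $\mathcal N$ to states $(m,j_0)$, and from states $(m,j_0)$ to states of $\mathcal N$ are arbitrary; there are no other transitions between $\mathcal N$ and $\mathcal R$. Within $\mathcal R$, the only transitions are $$q((m,j),(m,j+1))=\lambda_m\ (j\ge j_0),\qquad q((m,j),(m,j-1))=\mu_m\ (j\ge j_0+1),$$ $$q((m,j),(i,j+\Delta))=\alpha_m\langle i-m;\Delta\rangle\qquad(m<i\le M,\ \Delta\in\{-1,0,1\},\ j\ge j_0,\ j+\Delta\ge j_0).$$ For a phase $m$ with $\lambda_m,\mu_m>0$ put $$\alpha_m=\sum_{i=m+1}^M\sum_{\Delta=-1}^1\alpha_m\langle i-m;\Delta\rangle,\qquad \phi_m(s)=\frac{s+\lambda_m+\mu_m-\sqrt{(s+\lambda_m+\mu_m)^2-4\lambda_m\mu_m}}{2\lambda_m},$$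 $$r_m=\frac{\lambda_m}{\mu_m}\,\phi_m(\alpha_m),\qquad \Omega_m=\frac{r_m}{\lambda_m\,(1-r_m\phi_m(\alpha_m))}.$$ Let $P_m=\{(m,j):j\ge j_0+1\}$ and, for $\ell,j\ge j_0+1$, let $\mathbb E_{(m,\ell)}\big[T^{P_m}_{(m,j)}\big]$ be the expected cumulative time spent in state $(m,j)$ until the next transition leaving the set $P_m$, given the initial state $(m,\ell)$. **Theorem.** For any class $\mathbb M$ Markov chain, any phase $m$ with $\lambda_m,\mu_m>0$, and any levels $\ell,j\ge j_0+1$, this expectation is finite and $$\mathbb E_{(m,\ell)}\big[T^{P_m}_{(m,j)}\big]=\begin{cases}\Omega_m\, r_m^{\,j-\ell}\left(1-(r_m\phi_m(\alpha_m))^{\ell-j_0}\right)&\text{if }\ell\le j,\\[2pt] \Omega_m\,\phi_m(\alpha_m)^{\ell-j}\left(1-(r_m\phi_m(\alpha_m))^{j-j_0}\right)&\text{if }\ell\ge j.\end{cases}$$ -/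

import Mathlib

open MeasureTheory ProbabilityTheory
open scoped ENNReal NNReal

noncomputable section

/-! ### Continuous time Markov chains on a countable state space

A chain is given by its transition rates `q x y` (`x ≠ y`); the convention is `q x x = 0`.  It is
realised through its jump chain and its holding times: a sample path is a sequence of pairs
(state visited, length of that sojourn). -/

namespace CTMC

variable {S : Type*}

/-- The total rate `ν_x` out of the state `x`. -/
def exitRate (q : S → S → ℝ≥0) (x : S) : ℝ≥0∞ := ∑' y, (q x y : ℝ≥0∞)

open Classical in
/-- The law of the next state: `y` has probability `q x y / ν_x`.  An absorbing state (`ν_x = 0`)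
is never left.  (Chains with `ν_x = ∞` for some `x` are not considered; such an `x` is treated
as absorbing.) -/
def jumpLaw (q : S → S → ℝ≥0) (x : S) : PMF S :=
  if h : exitRate q x ≠ 0 ∧ exitRate q x ≠ ∞ then
    PMF.normalize (fun y => (q x y : ℝ≥0∞)) h.1 h.2
  else PMF.pure x

open Classical in
/-- The law of a sojourn time in `x`: exponential with rate `ν_x`, and infinite for an absorbing
state. -/
def holdingLaw (q : S → S → ℝ≥0) (x : S) : Measure ℝ≥0∞ :=
  if exitRate q x ≠ 0 ∧ exitRate q x ≠ ∞ then
    (expMeasure (exitRate q x).toReal).map ENNReal.ofReal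
  else Measure.dirac ∞

instance isProbabilityMeasure_holdingLaw (q : S → S → ℝ≥0) (x : S) :
    IsProbabilityMeasure (holdingLaw q x) := by
  unfold holdingLaw
  split_ifs with h
  · have := isProbabilityMeasure_expMeasure (ENNReal.toReal_pos h.1 h.2)
    exact Measure.isProbabilityMeasure_map ENNReal.measurable_ofReal.aemeasurable
  · infer_instance

/-- Sample paths: `ω n` is the `n`-th state visited together with the length of that sojourn. -/
abbrev Path (S : Type*) : Type _ := ℕ → S × ℝ≥0∞

variable [Countable S] [MeasurableSpace S] [DiscreteMeasurableSpace S]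

/-- The joint law of a state `x` and an independent sojourn time there. -/
def sojournKernel (q : S → S → ℝ≥0) : Kernel S (S × ℝ≥0∞) :=
  Kernel.ofFunOfCountable fun x => (Measure.dirac x).prod (holdingLaw q x)

instance (q : S → S → ℝ≥0) : IsMarkovKernel (sojournKernel q) :=
  ⟨fun x => inferInstanceAs (IsProbabilityMeasure ((Measure.dirac x).prod (holdingLaw q x)))⟩

/-- The transition kernel of the jump chain. -/
def jumpKernel (q : S → S → ℝ≥0) : Kernel S S :=
  Kernel.ofFunOfCountable fun x => (jumpLaw q x).toMeasure

instance (q : S → S → ℝ≥0) : IsMarkovKernel (jumpKernel q) :=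
  ⟨fun x => inferInstanceAs (IsProbabilityMeasure (jumpLaw q x).toMeasure)⟩

/-- Given the path up to its `n`-th sojourn, the next state is drawn by the jump chain from the
current state, and the next sojourn time is then drawn according to that new state. -/
def stepKernel (q : S → S → ℝ≥0) (n : ℕ) :
    Kernel (Π _ : Finset.Iic n, S × ℝ≥0∞) (S × ℝ≥0∞) :=
  (sojournKernel q ∘ₖ jumpKernel q).comap
    (fun h => (h ⟨n, Finset.mem_Iic.2 le_rfl⟩).1) (by fun_prop)

instance (q : S → S → ℝ≥0) (n : ℕ) : IsMarkovKernel (stepKernel q n) := by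
  unfold stepKernel; infer_instance

/-- The law `P_z` of the chain with rates `q` started in the state `z`. -/
def law (q : S → S → ℝ≥0) (z : S) : Measure (Path S) :=
  Kernel.trajMeasure (X := fun _ => S × ℝ≥0∞) (sojournKernel q z) (stepKernel q)

open Classical in
/-- `T_x^A`: the cumulative time spent in state `x` until the next transition leaving the set `A`,
i.e. the total length of those sojourns in `x` up to which only states in `A` were visited. -/
def timeBeforeLeaving (A : Set S) (x : S) (ω : Path S) : ℝ≥0∞ :=
  ∑' n, if (ω n).1 = x ∧ ∀ k ≤ n, (ω k).1 ∈ A then (ω n).2 else 0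

/-- `E_z[T_x^A]`: the expected cumulative time spent in state `x` until the next transition leaving
the set `A`, given the initial state `z`. -/
def expectedTime (q : S → S → ℝ≥0) (A : Set S) (z x : S) : ℝ≥0∞ :=
  ∫⁻ ω, timeBeforeLeaving A x ω ∂(law q z)

/-- The time of the first return to `z` of a path that starts in `z`: the first jump time `J_n`,
`n ≥ 1`, at which the path is in `z` (infinite if there is none). -/
def returnTime (z : S) (ω : Path S) : ℝ≥0∞ :=
  ⨅ (n : ℕ) (_ : 1 ≤ n ∧ (ω n).1 = z), ∑ k ∈ Finset.range n, (ω k).2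

/-- Every state can be reached from every state by transitions of positive rate. -/
def IsIrreducible (q : S → S → ℝ≥0) : Prop :=
  ∀ x y : S, Relation.ReflTransGen (fun a b => 0 < q a b) x y

/-- The state `x` is absorbing, or its expected return time is finite. -/
def IsPositiveRecurrent (q : S → S → ℝ≥0) (x : S) : Prop :=
  exitRate q x = 0 ∨ ∫⁻ ω, returnTime x ω ∂(law q x) < ∞

/-- A chain is ergodic if it is irreducible and all its states are positive recurrent. -/
structure IsErgodic (q : S → S → ℝ≥0) : Prop where
  irreducible : IsIrreducible q
  positiveRecurrent : ∀ x, IsPositiveRecurrent q x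

end CTMC

/-! ### Class M chains -/

/-- The state space: a non-repeating portion `N`, and the repeating portion consisting of the
states `(m, j)` with phase `0 ≤ m ≤ M` and level `j ≥ j₀`. -/
inductive ClassMState (N : Type*) (M j₀ : ℕ)
  | nonrep (x : N) : ClassMState N M j₀
  | rep (m : Fin (M + 1)) (j : ℕ) (hj : j₀ ≤ j) : ClassMState N M j₀

namespace ClassMState

variable {N : Type*} {M j₀ : ℕ}

instance : MeasurableSpace (ClassMState N M j₀) := ⊤

instance : DiscreteMeasurableSpace (ClassMState N M j₀) := ⟨fun _ => trivial⟩

instance [Countable N] : Countable (ClassMState N M j₀) := by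
  let f : N ⊕ (Fin (M + 1) × {j : ℕ // j₀ ≤ j}) → ClassMState N M j₀ :=
    Sum.elim nonrep fun p => rep p.1 p.2.1 p.2.2
  have hf : Function.Surjective f := by
    rintro (x | ⟨m, j, hj⟩)
    · exact ⟨Sum.inl x, rfl⟩
    · exact ⟨Sum.inr (m, ⟨j, hj⟩), rfl⟩
  exact hf.countable

end ClassMState

/-- The transition rates that make up a chain with the structure of class M. -/
structure ClassMRates (N : Type*) (M : ℕ) where
  /-- `λ_m`: the rate from `(m, j)` to `(m, j + 1)`. -/
  lam : Fin (M + 1) → ℝ≥0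
  /-- `μ_m`: the rate from `(m, j)` to `(m, j - 1)`. -/
  mu : Fin (M + 1) → ℝ≥0
  /-- For `m < i`, `alp m i Δ` is the rate from `(m, j)` to `(i, j + Δ)`, `Δ ∈ {-1, 0, 1}`
  (its values for `i ≤ m` are irrelevant). -/
  alp : Fin (M + 1) → Fin (M + 1) → SignType → ℝ≥0
  /-- The rates between two distinct states of `N`. -/
  rateNN : N → N → ℝ≥0
  /-- The rate from a state of `N` to the state `(m, j₀)`. -/
  rateNR : N → Fin (M + 1) → ℝ≥0
  /-- The rate from the state `(m, j₀)` to a state of `N`. -/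
  rateRN : Fin (M + 1) → N → ℝ≥0

namespace ClassMRates

variable {N : Type*} {M : ℕ} (C : ClassMRates N M)

open Classical in
/-- The transition rates `q(x, y)`, for `x ≠ y`, of the chain with repeating portion starting at
level `j₀`. -/
def rate (j₀ : ℕ) : ClassMState N M j₀ → ClassMState N M j₀ → ℝ≥0
  | .nonrep x, .nonrep y => if x = y then 0 else C.rateNN x y
  | .nonrep x, .rep m j _ => if j = j₀ then C.rateNR x m else 0
  | .rep m j _, .nonrep x => if j = j₀ then C.rateRN m x else 0
  | .rep m j _, .rep i j' _ =>
    if i = m then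
      if j' = j + 1 then C.lam m
      else if j = j' + 1 then C.mu m
      else 0
    else if m < i then
      if j' = j + 1 then C.alp m i 1
      else if j' = j then C.alp m i 0
      else if j = j' + 1 then C.alp m i (-1)
      else 0
    else 0

/-- The chain belongs to class M: besides having the structure above, it is ergodic. -/
def IsClassM [Countable N] (j₀ : ℕ) : Prop := CTMC.IsErgodic (C.rate j₀)

/-- `P_m`: the states in phase `m` with level at least `j₀ + 1`. -/
def phaseSet (N : Type*) {M : ℕ} (j₀ : ℕ) (m : Fin (M + 1)) : Set (ClassMState N M j₀) :=
  {x | ∃ (j : ℕ) (hj : j₀ + 1 ≤ j), x = .rep m j (Nat.le_of_succ_le hj)}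

/-- `α_m`: the total rate from a state in phase `m`, with level at least `j₀ + 1`, to other
phases. -/
def alphaTot (m : Fin (M + 1)) : ℝ := ∑ i ∈ Finset.Ioi m, ∑ Δ : SignType, (C.alp m i Δ : ℝ)

/-- `ρ_m`. -/
def rho (m : Fin (M + 1)) : ℝ := C.lam m / C.mu m

/-- `φ_m(s)`. -/
def phi (m : Fin (M + 1)) (s : ℝ) : ℝ :=
  (s + C.lam m + C.mu m - √((s + C.lam m + C.mu m) ^ 2 - 4 * C.lam m * C.mu m)) / (2 * C.lam m)

/-- The base `r_m`. -/
def r (m : Fin (M + 1)) : ℝ :=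
  if 0 < C.mu m then C.rho m * C.phi m (C.alphaTot m) else C.lam m / (C.lam m + C.alphaTot m)

/-- `Ω_m`. -/
def Omega (m : Fin (M + 1)) : ℝ :=
  C.r m / (C.lam m * (1 - C.r m * C.phi m (C.alphaTot m)))

end ClassMRates

end

/-!
The expected time in `(m, j)` is the expected number of visits to it, before the phase set `P_m` is
left, times the mean sojourn time `1 / ν`, where `ν = α_m + λ_m + μ_m` (`CTMC.expectedTime_eq`).
This holds because, at each jump, the next sojourn time depends on the past only through the state
entered (`CTMC.lintegral_tabooEvent`).

Number the states of `P_m` as `1, 2, …`, from the bottom up.  Inside `P_m` the chain is a nearest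
neighbour walk that steps up with probability `λ_m / ν`, down with probability `μ_m / ν`, and is
killed on leaving `P_m`.  Hence the expected numbers of visits `v` are the least nonnegative
solution of
`v k = [k = l] + (λ_m v (k - 1) + μ_m v (k + 1)) / ν` for `k ≥ 1`, with `v 0 = 0`.
The characteristic equation `μ_m x² - ν x + λ_m = 0` has the roots `r_m` and `1 / φ_m(α_m)`, and the
claimed formula, times `ν`, is a nonnegative solution (`greenWalk_recurrence`).  So `v` is at most
this solution, and the difference is a nonnegative homogeneous solution that vanishes at `0` and is
`O(r_m ^ k)`.  If `r_m < 1 / φ_m(α_m)`, it is zero (`eq_zero_of_recurrence`).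

The two roots coincide only if `α_m = 0` and `λ_m = μ_m`.  Then the walk is symmetric and unkilled
above the bottom level, and the expected numbers of visits during an excursion above level
`j₀ + 1` form an affine sequence that starts with `1`.  Such a sequence is not summable, so the mean
return time is infinite, against positive recurrence
(`ClassMRates.four_mul_lt_sq_phaseRate`).  This is the only place where ergodicity enters.
-/

/-! ### Sojourn times -/

/-- The mean of the exponential law.  Multiplying the density of the `Γ(1, r)` law by `x` gives
`1 / r` times the density of the `Γ(2, r)` law, whose total mass is `1`. -/
theorem lintegral_ofReal_expMeasure {r : ℝ} (hr : 0 < r) :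
    ∫⁻ x, ENNReal.ofReal x ∂(expMeasure r) = ENNReal.ofReal r⁻¹ := by
  have hdens : ∀ x : ℝ, gammaPDF 1 r x * ENNReal.ofReal x =
      ENNReal.ofReal r⁻¹ * gammaPDF 2 r x := by
    intro x
    rcases lt_or_ge x 0 with hx | hx
    · rw [gammaPDF_of_neg hx, gammaPDF_of_neg hx]; simp
    · rw [gammaPDF_of_nonneg hx, gammaPDF_of_nonneg hx, ← ENNReal.ofReal_mul (by positivity),
        ← ENNReal.ofReal_mul (by positivity)]
      congr 1
      norm_num [Real.Gamma_one, Real.Gamma_two]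
      field_simp
  have hm : Measurable (gammaPDF 1 r) := (measurable_gammaPDFReal 1 r).ennreal_ofReal
  rw [expMeasure, gammaMeasure, lintegral_withDensity_eq_lintegral_mul _ hm
    ENNReal.measurable_ofReal]
  simp only [Pi.mul_apply, hdens]
  rw [lintegral_const_mul' _ _ ENNReal.ofReal_ne_top, lintegral_gammaPDF_eq_one (by norm_num) hr,
    mul_one]

namespace CTMC

variable {S : Type*}

/-- In a state that is left at a finite positive rate, the mean sojourn time is the inverse of that
rate. -/
theorem lintegral_holdingLaw (q : S → S → ℝ≥0) (x : S) (h0 : exitRate q x ≠ 0)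
    (htop : exitRate q x ≠ ∞) : ∫⁻ t, t ∂(holdingLaw q x) = (exitRate q x)⁻¹ := by
  rw [holdingLaw, if_pos ⟨h0, htop⟩, lintegral_map (f := fun t => t) measurable_id
    ENNReal.measurable_ofReal, lintegral_ofReal_expMeasure (ENNReal.toReal_pos h0 htop),
    ENNReal.ofReal_inv_of_pos (ENNReal.toReal_pos h0 htop), ENNReal.ofReal_toReal htop]

theorem jumpLaw_apply (q : S → S → ℝ≥0) (x y : S) (h0 : exitRate q x ≠ 0)
    (htop : exitRate q x ≠ ∞) : jumpLaw q x y = q x y * (exitRate q x)⁻¹ := by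
  rw [jumpLaw, dif_pos ⟨h0, htop⟩]
  exact PMF.normalize_apply h0 htop y

/-! ### Taboo probabilities -/

open Classical in
/-- The taboo probability that the jump chain started in `z` is in `x` after `n` jumps, and that the
states it visited after the jumps `1, …, n` all lie in `A`.  The initial state is not required to
lie in `A`. -/
noncomputable def tabooProb (q : S → S → ℝ≥0) (A : Set S) (z : S) : ℕ → S → ℝ≥0∞
  | 0, x => if x = z then 1 else 0
  | n + 1, x => if x ∈ A then ∑' y, tabooProb q A z n y * jumpLaw q y x else 0

/-- The expected number of visits to `x` of the jump chain started in `z`, up to the first jump to a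
state outside `A`. -/
noncomputable def expectedVisits (q : S → S → ℝ≥0) (A : Set S) (z x : S) : ℝ≥0∞ :=
  ∑' n, tabooProb q A z n x

open Classical in
theorem expectedVisits_eq (q : S → S → ℝ≥0) (A : Set S) (z x : S) :
    expectedVisits q A z x = (if x = z then 1 else 0) +
      if x ∈ A then ∑' y, expectedVisits q A z y * jumpLaw q y x else 0 := by
  rw [expectedVisits, tsum_eq_zero_add' ENNReal.summable]
  congr 1
  split_ifs with h
  · simp only [tabooProb, if_pos h, expectedVisits]
    rw [ENNReal.tsum_comm]
    simp only [ENNReal.tsum_mul_right]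
  · simp [tabooProb, h]

open Classical in
/-- The expected numbers of visits form the least nonnegative solution of their equations. -/
theorem expectedVisits_le (q : S → S → ℝ≥0) (A : Set S) (z : S) (W : S → ℝ≥0∞)
    (hW : ∀ x, (if x = z then 1 else 0) + (if x ∈ A then ∑' y, W y * jumpLaw q y x else 0) ≤ W x)
    (x : S) : expectedVisits q A z x ≤ W x := by
  refine ENNReal.tsum_le_of_sum_range_le fun n => ?_
  induction n generalizing x with
  | zero => simp
  | succ n ih =>
    refine le_trans ?_ (hW x)
    rw [Finset.sum_range_succ', add_comm]
    refine add_le_add le_rfl ?_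
    split_ifs with h
    · simp only [tabooProb, if_pos h]
      rw [← Summable.tsum_finsetSum fun _ _ => ENNReal.summable]
      refine ENNReal.tsum_le_tsum fun y => ?_
      rw [← Finset.sum_mul]
      exact mul_le_mul_left (ih y) _
    · simp [tabooProb, h]

/-! ### Laws of paths -/

variable [MeasurableSpace S] [DiscreteMeasurableSpace S]

/-- The event that the `n`-th state is `x` and that the states after the jumps `1, …, n` all lie
in `A`. -/
def tabooEvent (A : Set S) (n : ℕ) (x : S) : Set (Path S) :=
  {ω | (ω n).1 = x ∧ ∀ k, 1 ≤ k → k ≤ n → (ω k).1 ∈ A}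

theorem measurableSet_tabooEvent (A : Set S) (n : ℕ) (x : S) :
    MeasurableSet (tabooEvent A n x) := by
  have hk : ∀ (k : ℕ) (B : Set S), MeasurableSet {ω : Path S | (ω k).1 ∈ B} := by
    intro k B
    have hm : Measurable fun ω : Path S => (ω k).1 := by fun_prop
    exact hm MeasurableSet.of_discrete
  have heq : tabooEvent A n x = {ω | (ω n).1 ∈ ({x} : Set S)} ∩
      ⋂ k, ⋂ _ : 1 ≤ k, ⋂ _ : k ≤ n, {ω | (ω k).1 ∈ A} := by
    ext; simp [tabooEvent]
  rw [heq]
  exact (hk _ _).inter (MeasurableSet.iInter fun k => MeasurableSet.iInter fun _ =>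
    MeasurableSet.iInter fun _ => hk k A)

variable [Countable S]

instance (q : S → S → ℝ≥0) (z : S) : IsProbabilityMeasure (law q z) := by
  unfold law; infer_instance

/-- The law of the initial state and of the first sojourn time. -/
theorem law_map_zero (q : S → S → ℝ≥0) (z : S) :
    (law q z).map (fun ω => ω 0) = sojournKernel q z := by
  have hcomp : (fun ω : Path S => ω 0) =
      (fun h : (Π _ : Finset.Iic 0, S × ℝ≥0∞) => h ⟨0, Finset.mem_Iic.2 le_rfl⟩) ∘
        Preorder.frestrictLe 0 := rfl
  rw [hcomp, ← Measure.map_map (by fun_prop) (by fun_prop), law, Kernel.trajMeasure,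
    Measure.map_comp _ _ (by fun_prop), Kernel.traj_map_frestrictLe, Kernel.partialTraj_self,
    Measure.id_comp, Measure.map_map (by fun_prop) (by fun_prop)]
  exact Measure.map_id

theorem lintegral_stepKernel (q : S → S → ℝ≥0) (n : ℕ) (h : Π _ : Finset.Iic n, S × ℝ≥0∞)
    {g : S × ℝ≥0∞ → ℝ≥0∞} (hg : Measurable g) :
    ∫⁻ p, g p ∂(stepKernel q n h) =
      ∑' y, jumpLaw q (h ⟨n, Finset.mem_Iic.2 le_rfl⟩).1 y * ∫⁻ p, g p ∂(sojournKernel q y) := by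
  rw [stepKernel, Kernel.comap_apply, Kernel.lintegral_comp _ _ _ hg, jumpKernel]
  change ∫⁻ y, _ ∂(PMF.toMeasure _) = _
  rw [lintegral_countable']
  refine tsum_congr fun y => ?_
  rw [PMF.toMeasure_apply_singleton _ _ (measurableSet_singleton y), mul_comm]

/-- The Markov property at the `n`-th jump. -/
theorem lintegral_law_succ (q : S → S → ℝ≥0) (z : S) (n : ℕ)
    {F : (Π _ : Finset.Iic n, S × ℝ≥0∞) → ℝ≥0∞} (hF : Measurable F)
    {g : S × ℝ≥0∞ → ℝ≥0∞} (hg : Measurable g) :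
    ∫⁻ ω, F (Preorder.frestrictLe n ω) * g (ω (n + 1)) ∂(law q z) =
      ∫⁻ ω, F (Preorder.frestrictLe n ω) *
        ∑' y, jumpLaw q (ω n).1 y * ∫⁻ p, g p ∂(sojournKernel q y) ∂(law q z) := by
  have key := Kernel.map_frestrictLe_trajMeasure_compProd_eq_map_trajMeasure
    (X := fun _ => S × ℝ≥0∞) (κ := stepKernel q) (μ₀ := sojournKernel q z) (a := n)
  have hFg : Measurable fun p : (Π _ : Finset.Iic n, S × ℝ≥0∞) × (S × ℝ≥0∞) => F p.1 * g p.2 := by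
    fun_prop
  have h1 : ∫⁻ ω, F (Preorder.frestrictLe n ω) * g (ω (n + 1)) ∂(law q z) =
      ∫⁻ p, F p.1 * g p.2 ∂((law q z).map fun ω => (Preorder.frestrictLe n ω, ω (n + 1))) := by
    rw [lintegral_map hFg (by fun_prop)]
  rw [h1, law, ← key, Measure.lintegral_compProd hFg, lintegral_map ?_ (by fun_prop)]
  · refine lintegral_congr fun ω => ?_
    dsimp only
    rw [lintegral_const_mul _ hg, lintegral_stepKernel q n _ hg]
    rfl
  · exact hFg.lintegral_kernel_prod_right'

open Classical in
theorem lintegral_sojournKernel_ite (q : S → S → ℝ≥0) (x y : S) {g : ℝ≥0∞ → ℝ≥0∞}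
    (hg : Measurable g) :
    ∫⁻ p, ({p : S × ℝ≥0∞ | p.1 = x}.indicator fun p => g p.2) p ∂(sojournKernel q y) =
      if y = x then ∫⁻ t, g t ∂(holdingLaw q x) else 0 := by
  have hm : Measurable ({p : S × ℝ≥0∞ | p.1 = x}.indicator fun p => g p.2) :=
    (hg.comp measurable_snd).indicator (measurable_fst (measurableSet_singleton x))
  change ∫⁻ p, _ ∂((Measure.dirac y).prod (holdingLaw q y)) = _
  rw [lintegral_prod _ hm.aemeasurable, lintegral_dirac]
  split_ifs with h
  · subst h; simp
  · simp [Set.indicator, h]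

/-- Given that the `n`-th state is `x` and that the states after the jumps `1, …, n` lie in `A`, the
length of the `n`-th sojourn has the law of a sojourn in `x`. -/
theorem lintegral_tabooEvent (q : S → S → ℝ≥0) (A : Set S) (z : S) (n : ℕ) (x : S)
    {g : ℝ≥0∞ → ℝ≥0∞} (hg : Measurable g) :
    ∫⁻ ω, (tabooEvent A n x).indicator (fun ω => g (ω n).2) ω ∂(law q z) =
      tabooProb q A z n x * ∫⁻ t, g t ∂(holdingLaw q x) := by
  classical
  have hm : ∀ (x : S) {g : ℝ≥0∞ → ℝ≥0∞}, Measurable g →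
      Measurable ({p : S × ℝ≥0∞ | p.1 = x}.indicator fun p => g p.2) := fun x g hg =>
    (hg.comp measurable_snd).indicator (measurable_fst (measurableSet_singleton x))
  induction n generalizing x g with
  | zero =>
    have h0 := lintegral_sojournKernel_ite q x z hg
    rw [← law_map_zero, lintegral_map (hm x hg) (by fun_prop)] at h0
    have hind : ∀ ω : Path S, (tabooEvent A 0 x).indicator (fun ω => g (ω 0).2) ω =
        ({p : S × ℝ≥0∞ | p.1 = x}.indicator fun p => g p.2) (ω 0) := by
      intro ω
      refine Set.indicator_eq_indicator ⟨fun h => h.1, fun h => ⟨h, fun k h1 h2 => by omega⟩⟩ rfl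
    rw [lintegral_congr hind, h0, tabooProb]
    simp only [eq_comm (a := z)]
    split_ifs <;> simp
  | succ n ih =>
    -- the past up to the `n`-th sojourn enters through the indicator `F` of the taboo
    let B : Set (Π _ : Finset.Iic n, S × ℝ≥0∞) :=
      ⋂ k : Finset.Iic n, ⋂ _ : 1 ≤ k.1, {h | (h k).1 ∈ A}
    have hB : MeasurableSet B := by
      refine MeasurableSet.iInter fun k => MeasurableSet.iInter fun _ => ?_
      have hk : Measurable fun h : (Π _ : Finset.Iic n, S × ℝ≥0∞) => (h k).1 := by fun_prop
      exact hk MeasurableSet.of_discrete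
    have hmemB : ∀ ω : Path S, Preorder.frestrictLe n ω ∈ B ↔
        ∀ k, 1 ≤ k → k ≤ n → (ω k).1 ∈ A := by
      intro ω
      simp only [B, Set.mem_iInter, Set.mem_ofPred_eq]
      exact ⟨fun h k h1 h2 => h ⟨k, Finset.mem_Iic.2 h2⟩ h1,
        fun h k h1 => h k.1 h1 (Finset.mem_Iic.1 k.2)⟩
    let F : (Π _ : Finset.Iic n, S × ℝ≥0∞) → ℝ≥0∞ := B.indicator 1
    have hF : Measurable F := measurable_one.indicator hB
    by_cases hx : x ∈ A
    · have hlhs : ∀ ω : Path S,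
          (tabooEvent A (n + 1) x).indicator (fun ω => g (ω (n + 1)).2) ω =
          F (Preorder.frestrictLe n ω) *
            ({p : S × ℝ≥0∞ | p.1 = x}.indicator fun p => g p.2) (ω (n + 1)) := by
        intro ω
        by_cases h2 : Preorder.frestrictLe n ω ∈ B
        · simp only [F, Set.indicator_of_mem h2, Pi.one_apply, one_mul]
          refine Set.indicator_eq_indicator ⟨fun h => h.1, fun h => ⟨h, fun k hk1 hk2 => ?_⟩⟩ rfl
          rcases Nat.le_succ_iff.1 hk2 with hk | rfl
          · exact (hmemB ω).1 h2 k hk1 hk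
          · have h' : (ω (n + 1)).1 = x := h
            rw [Nat.succ_eq_add_one, h']; exact hx
        · simp only [F, Set.indicator_of_notMem h2, zero_mul]
          exact Set.indicator_of_notMem
            (fun h => h2 ((hmemB ω).2 fun k hk1 hk2 => h.2 k hk1 (by omega))) _
      have hsum : ∀ ω : Path S, F (Preorder.frestrictLe n ω) *
          (∑' y, jumpLaw q (ω n).1 y *
            if y = x then ∫⁻ t, g t ∂(holdingLaw q x) else 0) =
          ∑' y, (tabooEvent A n y).indicator 1 ω *
            (jumpLaw q y x * ∫⁻ t, g t ∂(holdingLaw q x)) := by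
        intro ω
        rw [tsum_eq_single x (by intro y hy; simp [hy]), if_pos rfl, tsum_eq_single (ω n).1]
        · congr 1
          exact Set.indicator_eq_indicator
            ((hmemB ω).trans ⟨fun h => ⟨rfl, h⟩, fun h => h.2⟩) rfl
        · intro y hy
          rw [Set.indicator_of_notMem (fun h => hy h.1.symm), zero_mul]
      have hmeas : ∀ y, Measurable ((tabooEvent A n y).indicator (1 : Path S → ℝ≥0∞)) :=
        fun y => measurable_one.indicator (measurableSet_tabooEvent A n y)
      rw [lintegral_congr hlhs, lintegral_law_succ q z n hF (hm x hg)]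
      simp only [lintegral_sojournKernel_ite q x _ hg, hsum]
      rw [lintegral_tsum fun y => ((hmeas y).mul_const _).aemeasurable]
      simp only [tabooProb, if_pos hx]
      rw [← ENNReal.tsum_mul_right]
      refine tsum_congr fun y => ?_
      have hy := ih y (g := fun _ => 1) measurable_const
      rw [lintegral_const, measure_univ, mul_one, mul_one] at hy
      rw [lintegral_mul_const _ (hmeas y), mul_assoc, ← hy]
      rfl
    · have hz : ∀ ω : Path S,
          (tabooEvent A (n + 1) x).indicator (fun ω => g (ω (n + 1)).2) ω = 0 := fun ω =>
        Set.indicator_of_notMem (fun h => hx <| by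
          have h' := h.2 (n + 1) (by omega) le_rfl
          rwa [h.1] at h') _
      simp [lintegral_congr hz, tabooProb, hx]

theorem lintegral_tsum_tabooEvent (q : S → S → ℝ≥0) (A : Set S) (z x : S) :
    ∫⁻ ω, ∑' n, (tabooEvent A n x).indicator (fun ω => (ω n).2) ω ∂(law q z) =
      expectedVisits q A z x * ∫⁻ t, t ∂(holdingLaw q x) := by
  rw [lintegral_tsum]
  · simp only [lintegral_tabooEvent q A z _ x measurable_id', expectedVisits,
      ENNReal.tsum_mul_right]
  · intro n
    exact ((show Measurable fun ω : Path S => (ω n).2 by fun_prop).indicator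
      (measurableSet_tabooEvent A n x)).aemeasurable

theorem expectedTime_eq (q : S → S → ℝ≥0) {A : Set S} {z : S} (hz : z ∈ A) (x : S) :
    expectedTime q A z x = expectedVisits q A z x * ∫⁻ t, t ∂(holdingLaw q x) := by
  classical
  rw [← lintegral_tsum_tabooEvent, expectedTime]
  have hstart : ∀ᵐ ω ∂(law q z), (ω 0).1 = z := by
    have hm : MeasurableSet {p : S × ℝ≥0∞ | p.1 = z} :=
      measurable_fst (measurableSet_singleton z)
    have h : ∀ᵐ p ∂((law q z).map fun ω => ω 0), p.1 = z := by
      rw [law_map_zero]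
      change ∀ᵐ p ∂((Measure.dirac z).prod (holdingLaw q z)), p.1 = z
      rw [Measure.ae_prod_iff_ae_ae hm, ae_dirac_iff (by simp)]
      simp
    exact ae_of_ae_map (measurable_pi_apply 0).aemeasurable h
  refine lintegral_congr_ae ?_
  filter_upwards [hstart] with ω hω
  refine tsum_congr fun n => ?_
  rw [Set.indicator_apply]
  refine if_congr (and_congr_right fun _ => ⟨fun h k _ hk => h k hk, fun h k hk => ?_⟩) rfl rfl
  rcases Nat.eq_zero_or_pos k with rfl | hk0
  · rwa [hω]
  · exact h k hk0 hk

/-- If `z ∉ A`, then the sojourns of a path from `z` up to the first jump to a state outside `A` all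
come before its first return to `z`. -/
theorem tsum_expectedVisits_le (q : S → S → ℝ≥0) {A : Set S} {z : S} (hz : z ∉ A) :
    ∑' x, expectedVisits q A z x * ∫⁻ t, t ∂(holdingLaw q x) ≤
      ∫⁻ ω, returnTime z ω ∂(law q z) := by
  simp only [← lintegral_tsum_tabooEvent]
  rw [← lintegral_tsum]
  swap
  · intro x
    refine (Measurable.tsum fun n => ?_).aemeasurable
    exact (show Measurable fun ω : Path S => (ω n).2 by fun_prop).indicator
      (measurableSet_tabooEvent A n x)
  refine lintegral_mono fun ω => ?_
  refine le_iInf₂ fun N hN => ?_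
  rw [ENNReal.tsum_comm]
  have hzero : ∀ n ∉ Finset.range N,
      ∑' x, (tabooEvent A n x).indicator (fun ω => (ω n).2) ω = 0 := by
    intro n hn
    rw [Finset.mem_range, not_lt] at hn
    refine ENNReal.tsum_eq_zero.2 fun x => Set.indicator_of_notMem (fun h => hz ?_) _
    rw [← hN.2]
    exact h.2 N hN.1 hn
  rw [tsum_eq_sum hzero]
  refine Finset.sum_le_sum fun n _ => ?_
  rw [tsum_eq_single (ω n).1]
  · exact Set.indicator_le_self _ _ _
  · exact fun y hy => Set.indicator_of_notMem (fun h => hy h.1.symm) _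

end CTMC

namespace ClassMRates

variable {N : Type*} {M : ℕ} (C : ClassMRates N M)

/-! ### The walk inside a phase -/

/-- The state of phase `m` that lies `k` levels above the lowest level `j₀`. -/
def phaseState (N : Type*) {M : ℕ} (j₀ : ℕ) (m : Fin (M + 1)) (k : ℕ) : ClassMState N M j₀ :=
  .rep m (j₀ + k) (Nat.le_add_right _ _)

/-- The total rate `α_m + λ_m + μ_m` out of each state of phase `m` above level `j₀`. -/
noncomputable def phaseRate (m : Fin (M + 1)) : ℝ := C.alphaTot m + C.lam m + C.mu m

theorem alphaTot_nonneg (m : Fin (M + 1)) : 0 ≤ C.alphaTot m := by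
  unfold alphaTot; positivity

theorem phaseRate_pos {m : Fin (M + 1)} (hlam : 0 < C.lam m) : 0 < C.phaseRate m := by
  have h1 := C.alphaTot_nonneg m
  have h2 : (0 : ℝ) < C.lam m := hlam
  have h3 : (0 : ℝ) ≤ C.mu m := (C.mu m).2
  unfold phaseRate; linarith

theorem phaseState_injective (N : Type*) (j₀ : ℕ) (m : Fin (M + 1)) :
    Function.Injective (phaseState N j₀ m) := by
  intro a b h
  simpa [phaseState] using h

theorem phaseState_inj {j₀ : ℕ} {m : Fin (M + 1)} {a b : ℕ} :
    phaseState N j₀ m a = phaseState N j₀ m b ↔ a = b :=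
  (phaseState_injective N j₀ m).eq_iff

theorem mem_phaseSet_iff {j₀ : ℕ} {m : Fin (M + 1)} {x : ClassMState N M j₀} :
    x ∈ phaseSet N j₀ m ↔ ∃ k, x = phaseState N j₀ m (k + 1) := by
  constructor
  · rintro ⟨j, hj, rfl⟩
    refine ⟨j - (j₀ + 1), ?_⟩
    simp only [phaseState, ClassMState.rep.injEq, true_and]
    omega
  · rintro ⟨k, rfl⟩
    exact ⟨j₀ + (k + 1), by omega, rfl⟩

theorem rate_phaseState_rep (j₀ : ℕ) (m i : Fin (M + 1)) (k j : ℕ) (hj : j₀ ≤ j) :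
    C.rate j₀ (phaseState N j₀ m k) (.rep i j hj) =
      if i = m then
        if j = j₀ + k + 1 then C.lam m else if j₀ + k = j + 1 then C.mu m else 0
      else if m < i then
        if j = j₀ + k + 1 then C.alp m i 1
        else if j = j₀ + k then C.alp m i 0
        else if j₀ + k = j + 1 then C.alp m i (-1)
        else 0
      else 0 := rfl

theorem rate_phaseState (j₀ : ℕ) (m : Fin (M + 1)) (k k' : ℕ) :
    C.rate j₀ (phaseState N j₀ m k) (phaseState N j₀ m k') =
      if k' = k + 1 then C.lam m else if k = k' + 1 then C.mu m else 0 := by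
  rw [phaseState, phaseState]
  change (if m = m then
      if j₀ + k' = j₀ + k + 1 then C.lam m else if j₀ + k = j₀ + k' + 1 then C.mu m else 0
    else _) = _
  rw [if_pos rfl]
  simp only [add_assoc, add_right_inj]

theorem exitRate_phaseState (j₀ : ℕ) (m : Fin (M + 1)) (k : ℕ) :
    CTMC.exitRate (C.rate j₀) (phaseState N j₀ m (k + 1)) = ENNReal.ofReal (C.phaseRate m) := by
  -- the states that can be entered next are the `rep i (j₀ + k + 1 + Δ)`
  let e : Fin (M + 1) × SignType → ClassMState N M j₀ := fun p =>
    phaseState N j₀ p.1 (match p.2 with | -1 => k | 0 => k + 1 | 1 => k + 2)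
  have he : Function.Injective e := by
    rintro ⟨i, a⟩ ⟨i', a'⟩ h
    simp only [e, phaseState, ClassMState.rep.injEq] at h
    obtain ⟨rfl, h⟩ := h
    cases a <;> cases a' <;> first | rfl | (exfalso; simp at h)
  have hsupp : Function.support
      (fun y => (C.rate j₀ (phaseState N j₀ m (k + 1)) y : ℝ≥0∞)) ⊆ Set.range e := by
    rintro (x | ⟨i, j, hj⟩) hy
    · simp [rate, phaseState] at hy
    · rw [Function.mem_support, Ne, ENNReal.coe_eq_zero, rate_phaseState_rep] at hy
      by_cases h1 : j = j₀ + (k + 1) + 1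
      · exact ⟨(i, 1), by subst h1; rfl⟩
      by_cases h2 : j = j₀ + (k + 1)
      · exact ⟨(i, 0), by subst h2; rfl⟩
      by_cases h3 : j = j₀ + k
      · exact ⟨(i, -1), by subst h3; rfl⟩
      · have h3' : j₀ + (k + 1) ≠ j + 1 := by omega
        simp [h1, h2, h3'] at hy
  have hval : ∀ i, ∑ a, (C.rate j₀ (phaseState N j₀ m (k + 1)) (e (i, a)) : ℝ) =
      (if i = m then (C.lam m + C.mu m : ℝ) else 0) +
        if m < i then ∑ a, (C.alp m i a : ℝ) else 0 := by
    intro i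
    have huniv : (Finset.univ : Finset SignType) = {0, -1, 1} := rfl
    have h1 : j₀ + k ≠ j₀ + (k + 1) + 1 := by omega
    have h2 : j₀ + (k + 1) ≠ j₀ + (k + 1) + 1 := by omega
    have h3 : j₀ + k ≠ j₀ + (k + 1) := by omega
    have h4 : j₀ + (k + 2) = j₀ + (k + 1) + 1 := by omega
    have h5 : j₀ + (k + 1) = j₀ + k + 1 := by omega
    rw [huniv]
    rw [Finset.sum_insert (by decide), Finset.sum_insert (by decide), Finset.sum_singleton,
      Finset.sum_insert (by decide), Finset.sum_insert (by decide), Finset.sum_singleton]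
    simp only [e]
    rw [show phaseState N j₀ i (k + 1) = .rep i (j₀ + (k + 1)) (Nat.le_add_right _ _) from rfl,
      show phaseState N j₀ i k = .rep i (j₀ + k) (Nat.le_add_right _ _) from rfl,
      show phaseState N j₀ i (k + 2) = .rep i (j₀ + (k + 2)) (Nat.le_add_right _ _) from rfl,
      rate_phaseState_rep, rate_phaseState_rep, rate_phaseState_rep]
    rw [if_neg h1, if_neg h1, if_neg h2, if_neg h2, if_neg h3, if_pos h4, if_pos h4, if_pos h5,
      if_pos h5, if_pos rfl]
    by_cases him : i = m
    · subst him
      simp [add_comm]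
    · by_cases hlt : m < i <;> simp [him, hlt]
  rw [CTMC.exitRate, ← he.tsum_eq hsupp, tsum_fintype, ← ENNReal.ofReal_toReal (a := ∑ b, _)
    (ENNReal.sum_ne_top.2 fun _ _ => ENNReal.coe_ne_top)]
  congr 1
  rw [ENNReal.toReal_sum fun _ _ => ENNReal.coe_ne_top]
  simp only [ENNReal.coe_toReal]
  rw [Fintype.sum_prod_type]
  simp only [hval]
  rw [Finset.sum_add_distrib, Finset.sum_ite_eq' Finset.univ m, if_pos (Finset.mem_univ m),
    ← Finset.sum_filter, phaseRate, alphaTot]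
  have : Finset.univ.filter (fun i => m < i) = Finset.Ioi m := by ext; simp
  rw [this]; ring

theorem lintegral_holdingLaw_phaseState (j₀ : ℕ) {m : Fin (M + 1)} (hlam : 0 < C.lam m) (k : ℕ) :
    ∫⁻ t, t ∂(CTMC.holdingLaw (C.rate j₀) (phaseState N j₀ m (k + 1))) =
      ENNReal.ofReal (C.phaseRate m)⁻¹ := by
  have hpos := C.phaseRate_pos hlam
  rw [CTMC.lintegral_holdingLaw, exitRate_phaseState, ENNReal.ofReal_inv_of_pos hpos]
  · rw [exitRate_phaseState]; simpa using hpos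
  · rw [exitRate_phaseState]; exact ENNReal.ofReal_ne_top

theorem tsum_mul_jumpLaw (j₀ : ℕ) {m : Fin (M + 1)} (hlam : 0 < C.lam m)
    {W : ClassMState N M j₀ → ℝ≥0∞} (hW : ∀ x ∉ phaseSet N j₀ m, W x = 0) (k : ℕ) :
    ∑' y, W y * CTMC.jumpLaw (C.rate j₀) y (phaseState N j₀ m (k + 1)) =
      (W (phaseState N j₀ m k) * C.lam m + W (phaseState N j₀ m (k + 2)) * C.mu m) *
        ENNReal.ofReal (C.phaseRate m)⁻¹ := by
  have hpos := C.phaseRate_pos hlam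
  have h0 : W (phaseState N j₀ m 0) = 0 := by
    refine hW _ fun h => ?_
    obtain ⟨k, hk⟩ := mem_phaseSet_iff.1 h
    exact absurd (phaseState_inj.1 hk) (by omega)
  have hsupp : Function.support
      (fun y => W y * CTMC.jumpLaw (C.rate j₀) y (phaseState N j₀ m (k + 1))) ⊆
      Set.range (phaseState N j₀ m) := by
    intro y hy
    by_contra hc
    refine hy ?_
    dsimp only
    rw [hW y, zero_mul]
    intro h
    obtain ⟨k, rfl⟩ := mem_phaseSet_iff.1 h
    exact hc ⟨_, rfl⟩
  have hjump : ∀ a, W (phaseState N j₀ m a) *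
      CTMC.jumpLaw (C.rate j₀) (phaseState N j₀ m a) (phaseState N j₀ m (k + 1)) =
      W (phaseState N j₀ m a) * (if a = k then C.lam m else if a = k + 2 then C.mu m else 0 : ℝ≥0) *
        ENNReal.ofReal (C.phaseRate m)⁻¹ := by
    intro a
    rcases a with _ | a
    · simp [h0]
    · rw [CTMC.jumpLaw_apply, exitRate_phaseState, ENNReal.ofReal_inv_of_pos hpos, rate_phaseState,
        mul_assoc]
      · simp only [add_left_inj, eq_comm (a := k)]
      · rw [exitRate_phaseState]; simpa using hpos
      · rw [exitRate_phaseState]; exact ENNReal.ofReal_ne_top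
  rw [← (phaseState_injective N j₀ m).tsum_eq hsupp]
  simp only [hjump]
  rw [ENNReal.tsum_mul_right, tsum_eq_sum (s := {k, k + 2})]
  · rw [Finset.sum_pair (by omega)]
    simp
  · intro b hb
    simp only [Finset.mem_insert, Finset.mem_singleton, not_or] at hb
    simp [hb.1, hb.2]

end ClassMRates

/-! ### Second order recurrences -/

/-- A nonnegative solution of the recurrence with characteristic roots `r < R` that vanishes at `0`
is a multiple of `R ^ k - r ^ k`, so it is zero if it is `O(r ^ k)`. -/
theorem eq_zero_of_recurrence {r R K : ℝ} {l : ℕ} {D : ℕ → ℝ} (hr : 0 < r) (hrR : r < R)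
    (h0 : D 0 = 0) (hrec : ∀ k, D (k + 2) = (r + R) * D (k + 1) - r * R * D k)
    (hnonneg : ∀ k, 0 ≤ D k) (hle : ∀ k, l ≤ k → D k ≤ K * r ^ k) (k : ℕ) : D k = 0 := by
  have hdiff : ∀ k, D (k + 1) - r * D k = R ^ k * D 1 := by
    intro k
    induction k with
    | zero => simp [h0]
    | succ k ih => rw [hrec, pow_succ]; linear_combination R * ih
  have h1 : D 1 = 0 := by
    by_contra hne
    have hpos : 0 < D 1 := lt_of_le_of_ne (hnonneg 1) (Ne.symm hne)
    have htend := tendsto_pow_atTop_atTop_of_one_lt ((one_lt_div hr).2 hrR)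
    obtain ⟨n, hn, hln⟩ := ((htend.eventually_gt_atTop (K * r / D 1)).and
      (Filter.eventually_ge_atTop l)).exists
    rw [div_pow, div_lt_div_iff₀ hpos (by positivity)] at hn
    have h2 := hle (n + 1) (by omega)
    have h3 := hdiff n
    have h4 := mul_nonneg hr.le (hnonneg n)
    rw [pow_succ] at h2
    linarith
  have hstep : ∀ k, D k = 0 ∧ D (k + 1) = 0 := by
    intro k
    induction k with
    | zero => exact ⟨h0, h1⟩
    | succ k ih => exact ⟨ih.2, by rw [hrec, ih.1, ih.2]; ring⟩
  exact (hstep k).1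

/-- A solution of the recurrence of the symmetric random walk is affine, so it is not summable
unless it is zero. -/
theorem not_summable_of_affine_recurrence {a : ℕ → ℝ} (h0 : a 0 = 1)
    (hrec : ∀ k, 2 * a (k + 1) = a k + a (k + 2)) : ¬ Summable a := by
  intro hs
  have haff : ∀ k, a (k + 1) - a k = a 1 - 1 := by
    intro k
    induction k with
    | zero => rw [h0]
    | succ k ih => linarith [hrec k]
  have hlim := hs.tendsto_atTop_zero
  have hdiff : Filter.Tendsto (fun k => a (k + 1) - a k) Filter.atTop (nhds (0 - 0)) :=
    ((Filter.tendsto_add_atTop_iff_nat 1).2 hlim).sub hlim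
  simp only [haff, sub_zero] at hdiff
  have hslope : a 1 - 1 = 0 := tendsto_nhds_unique tendsto_const_nhds hdiff
  have hconst : ∀ k, a k = 1 := by
    intro k
    induction k with
    | zero => exact h0
    | succ k ih => linarith [haff k]
  exact one_ne_zero (tendsto_nhds_unique tendsto_const_nhds (hlim.congr hconst))

/-- The Green function at `k`, for the starting point `l`, of a nearest neighbour walk on the
positive integers that is killed at a constant rate and on reaching `0`.  Here `r` and `f⁻¹` are the
characteristic roots, and `Om` is the normalising constant. -/
noncomputable def greenWalk (Om r f : ℝ) (l k : ℕ) : ℝ :=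
  if l ≤ k then Om * r ^ (k - l) * (1 - (r * f) ^ l) else Om * f ^ (l - k) * (1 - (r * f) ^ k)

theorem greenWalk_of_le {Om r f : ℝ} {l k : ℕ} (h : l ≤ k) :
    greenWalk Om r f l k = Om * r ^ (k - l) * (1 - (r * f) ^ l) := if_pos h

theorem greenWalk_of_ge {Om r f : ℝ} {l k : ℕ} (h : k ≤ l) :
    greenWalk Om r f l k = Om * f ^ (l - k) * (1 - (r * f) ^ k) := by
  rcases h.eq_or_lt with rfl | h'
  · rw [greenWalk_of_le le_rfl, Nat.sub_self, pow_zero, pow_zero]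
  · exact if_neg h'.not_ge

theorem greenWalk_zero (Om r f : ℝ) (l : ℕ) : greenWalk Om r f l 0 = 0 := by
  rw [greenWalk_of_ge (Nat.zero_le l)]; simp

theorem greenWalk_nonneg {Om r f : ℝ} (hOm : 0 ≤ Om) (hr : 0 ≤ r) (hf : 0 ≤ f) (hrf : r * f ≤ 1)
    (l k : ℕ) : 0 ≤ greenWalk Om r f l k := by
  have hx : ∀ n, 0 ≤ 1 - (r * f) ^ n := fun n =>
    sub_nonneg.2 (pow_le_one₀ (mul_nonneg hr hf) hrf)
  unfold greenWalk
  split_ifs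
  · exact mul_nonneg (by positivity) (hx l)
  · exact mul_nonneg (by positivity) (hx k)

theorem greenWalk_recurrence {lam mu nu r f : ℝ} (hlam : 0 < lam) (hmu : 0 < mu)
    (hr0 : r ≠ 0) (hr : mu * r = lam * f) (hf : nu * f = lam * f ^ 2 + mu) (hrf : r * f ≠ 1)
    (l k : ℕ) :
    nu * greenWalk (r / (lam * (1 - r * f))) r f l (k + 1) =
      (if k + 1 = l then 1 else 0) + lam * greenWalk (r / (lam * (1 - r * f))) r f l k +
        mu * greenWalk (r / (lam * (1 - r * f))) r f l (k + 2) := by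
  have hquad : nu * r = lam + mu * r ^ 2 := by
    have h : mu * (nu * r) = mu * (lam + mu * r ^ 2) := by
      linear_combination (nu - mu * r - lam * f) * hr + lam * hf
    exact mul_left_cancel₀ hmu.ne' h
  have hsub : 1 - r * f ≠ 0 := sub_ne_zero.2 (Ne.symm hrf)
  set Om := r / (lam * (1 - r * f)) with hOm
  have hOm' : lam * Om * (1 - r * f) = r := by
    rw [hOm]; field_simp
  clear_value Om
  rcases lt_trichotomy (k + 1) l with h | h | h
  · obtain ⟨n, rfl⟩ : ∃ n, l = k + 2 + n := ⟨l - (k + 2), by omega⟩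
    rw [if_neg h.ne, greenWalk_of_ge (by omega), greenWalk_of_ge (by omega),
      greenWalk_of_ge (by omega), show k + 2 + n - (k + 1) = n + 1 by omega,
      show k + 2 + n - k = n + 2 by omega, show k + 2 + n - (k + 2) = n by omega]
    have hx : nu * f * (r * f) = lam * f ^ 2 + mu * (r * f) ^ 2 := by
      linear_combination f ^ 2 * hquad
    linear_combination Om * f ^ n * hf - Om * f ^ n * (r * f) ^ k * hx
  · subst h
    rw [if_pos rfl, greenWalk_of_le le_rfl, greenWalk_of_ge (by omega), greenWalk_of_le (by omega),
      show k + 1 - (k + 1) = 0 by omega, show k + 1 - k = 1 by omega,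
      show k + 2 - (k + 1) = 1 by omega]
    refine mul_left_cancel₀ hr0 ?_
    have hf' : r * (nu - mu * r - lam * f) = lam * (1 - r * f) := by
      linear_combination hquad
    linear_combination Om * (1 - (r * f) ^ (k + 1)) * hf' + hOm'
  · obtain ⟨n, rfl⟩ : ∃ n, k = l + n := ⟨k - l, by omega⟩
    rw [if_neg h.ne', greenWalk_of_le (by omega), greenWalk_of_le (by omega),
      greenWalk_of_le (by omega), show l + n + 1 - l = n + 1 by omega,
      show l + n - l = n by omega, show l + n + 2 - l = n + 2 by omega]
    linear_combination Om * r ^ n * (1 - (r * f) ^ l) * hquad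

namespace ClassMRates

variable {N : Type*} {M : ℕ} (C : ClassMRates N M)

/-! ### Expected visits inside a phase -/

theorem expectedVisits_phaseState (j₀ : ℕ) {m : Fin (M + 1)} (hlam : 0 < C.lam m)
    {A : Set (ClassMState N M j₀)} (hA : A ⊆ phaseSet N j₀ m) {l : ℕ} {k : ℕ}
    (hk : phaseState N j₀ m (k + 1) ∈ A) :
    CTMC.expectedVisits (C.rate j₀) A (phaseState N j₀ m (l + 1)) (phaseState N j₀ m (k + 1)) =
      (if k = l then 1 else 0) +
      (CTMC.expectedVisits (C.rate j₀) A (phaseState N j₀ m (l + 1)) (phaseState N j₀ m k) *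
          C.lam m +
        CTMC.expectedVisits (C.rate j₀) A (phaseState N j₀ m (l + 1)) (phaseState N j₀ m (k + 2)) *
          C.mu m) * ENNReal.ofReal (C.phaseRate m)⁻¹ := by
  classical
  rw [CTMC.expectedVisits_eq, if_pos hk, tsum_mul_jumpLaw C j₀ hlam]
  · simp only [phaseState_inj, add_left_inj]
  · intro x hx
    rw [CTMC.expectedVisits_eq, if_neg, if_neg fun h => hx (hA h), add_zero]
    rintro rfl
    exact hx (mem_phaseSet_iff.2 ⟨l, rfl⟩)

/-- Were the discriminant zero, i.e. `α_m = 0` and `λ_m = μ_m`, the walk inside phase `m` would be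
the symmetric random walk, whose expected return times are infinite, against positive
recurrence. -/
theorem four_mul_lt_sq_phaseRate [Countable N] {j₀ : ℕ} (hC : C.IsClassM j₀) {m : Fin (M + 1)}
    (hlam : 0 < C.lam m) : 4 * (C.lam m : ℝ) * C.mu m < C.phaseRate m ^ 2 := by
  have hα := C.alphaTot_nonneg m
  have hl : (0 : ℝ) < C.lam m := hlam
  have hμ : (0 : ℝ) ≤ C.mu m := (C.mu m).2
  have hpos := C.phaseRate_pos hlam
  by_contra hnot
  rw [not_lt] at hnot
  unfold phaseRate at hnot
  -- `(α + λ + μ)² ≤ 4λμ` means that `α² + 2α(λ + μ) + (λ - μ)² ≤ 0`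
  have hα0 : C.alphaTot m = 0 := by
    nlinarith [sq_nonneg ((C.lam m : ℝ) - C.mu m)]
  have hlm : (C.mu m : ℝ) = C.lam m := by
    rw [hα0] at hnot
    nlinarith [sq_nonneg ((C.lam m : ℝ) - C.mu m)]
  have hrate : C.phaseRate m = 2 * C.lam m := by rw [phaseRate, hα0, hlm]; ring
  -- excursions from level `j₀ + 1` to the levels above it
  let z : ClassMState N M j₀ := phaseState N j₀ m 1
  let A : Set (ClassMState N M j₀) := {x | ∃ k, x = phaseState N j₀ m (k + 2)}
  have hA : A ⊆ phaseSet N j₀ m := by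
    rintro _ ⟨k, rfl⟩
    exact mem_phaseSet_iff.2 ⟨k + 1, rfl⟩
  have hz : z ∉ A := by
    rintro ⟨k, hk⟩
    exact absurd (phaseState_inj.1 hk) (by omega)
  let v : ℕ → ℝ≥0∞ := fun k => CTMC.expectedVisits (C.rate j₀) A z (phaseState N j₀ m (k + 1))
  have hv0 : v 0 = 1 := by
    classical
    simp only [v]
    rw [CTMC.expectedVisits_eq, if_neg (show phaseState N j₀ m (0 + 1) ∉ A from hz), add_zero]
    exact if_pos rfl
  have hvrec : ∀ k, v (k + 1) =
      (v k * C.lam m + v (k + 2) * C.mu m) * ENNReal.ofReal (C.phaseRate m)⁻¹ := by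
    intro k
    have h := C.expectedVisits_phaseState j₀ hlam hA (l := 0) (k := k + 1) ⟨k, rfl⟩
    rw [if_neg (Nat.succ_ne_zero k)] at h
    exact h.trans (zero_add _)
  have hret : ∫⁻ ω, CTMC.returnTime z ω ∂(CTMC.law (C.rate j₀) z) < ∞ := by
    refine (hC.positiveRecurrent z).resolve_left ?_
    have h := C.exitRate_phaseState (N := N) j₀ m 0
    rw [zero_add] at h
    rw [h]
    simpa using hpos
  have hsum : (∑' k, v k) * ENNReal.ofReal (C.phaseRate m)⁻¹ < ∞ := by
    refine lt_of_le_of_lt ?_ hret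
    refine le_trans ?_ (CTMC.tsum_expectedVisits_le (C.rate j₀) hz)
    rw [← ENNReal.tsum_mul_right]
    have hinj : Function.Injective fun k => phaseState N j₀ m (k + 1) :=
      (phaseState_injective N j₀ m).comp (add_left_injective 1)
    refine le_trans (le_of_eq ?_) (ENNReal.tsum_comp_le_tsum_of_injective hinj _)
    refine tsum_congr fun k => ?_
    rw [C.lintegral_holdingLaw_phaseState j₀ hlam]
  have hsum' : ∑' k, v k ≠ ∞ := by
    intro h
    rw [h, ENNReal.top_mul] at hsum
    · exact lt_irrefl _ hsum
    · simpa using hpos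
  have hvtop := ENNReal.ne_top_of_tsum_ne_top hsum'
  refine not_summable_of_affine_recurrence (a := fun k => (v k).toReal) (by simp [hv0]) ?_
    (ENNReal.summable_toReal hsum')
  intro k
  rw [hvrec, ENNReal.toReal_mul, ENNReal.toReal_add, ENNReal.toReal_mul, ENNReal.toReal_mul,
    ENNReal.toReal_ofReal (by positivity), hrate, ENNReal.coe_toReal, ENNReal.coe_toReal, hlm]
  · field_simp
  · exact ENNReal.mul_ne_top (hvtop _) ENNReal.coe_ne_top
  · exact ENNReal.mul_ne_top (hvtop _) ENNReal.coe_ne_top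

/-- The expected numbers of visits, being the least nonnegative solution of their equations, are
bounded by the Green function of the walk.  The difference solves the homogeneous recurrence and is
`O(r ^ k)`, so it vanishes. -/
theorem expectedVisits_phaseSet {j₀ : ℕ} {m : Fin (M + 1)} (hlam : 0 < C.lam m)
    (hmu : 0 < C.mu m) {r f : ℝ} (hr0 : 0 < r) (hf0 : 0 < f)
    (hr : C.mu m * r = C.lam m * f) (hf : C.phaseRate m * f = C.lam m * f ^ 2 + C.mu m)
    (hrf : r * f < 1) (l k : ℕ) :
    CTMC.expectedVisits (C.rate j₀) (phaseSet N j₀ m) (phaseState N j₀ m (l + 1))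
        (phaseState N j₀ m k) =
      ENNReal.ofReal
        (C.phaseRate m * greenWalk (r / (C.lam m * (1 - r * f))) r f (l + 1) k) := by
  classical
  have hl : (0 : ℝ) < C.lam m := hlam
  have hμ : (0 : ℝ) < C.mu m := hmu
  have hpos := C.phaseRate_pos hlam
  have hOm : 0 ≤ r / (C.lam m * (1 - r * f)) :=
    div_nonneg hr0.le (mul_nonneg hl.le (by linarith))
  have hrec := greenWalk_recurrence hl hμ hr0.ne' hr hf hrf.ne (l + 1)
  set Om := r / (C.lam m * (1 - r * f)) with hOm'
  clear_value Om
  set ν := C.phaseRate m with hν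
  clear_value ν
  set G := greenWalk Om r f (l + 1) with hG
  have hG0 : G 0 = 0 := greenWalk_zero _ _ _ _
  have hGnn : ∀ k, 0 ≤ G k := greenWalk_nonneg hOm hr0.le hf0.le hrf.le _
  set v : ℕ → ℝ≥0∞ := fun k => CTMC.expectedVisits (C.rate j₀) (phaseSet N j₀ m)
    (phaseState N j₀ m (l + 1)) (phaseState N j₀ m k) with hv
  have hnot0 : phaseState N j₀ m 0 ∉ phaseSet N j₀ m := by
    intro h
    obtain ⟨k, hk⟩ := mem_phaseSet_iff.1 h
    exact absurd (phaseState_inj.1 hk) (by omega)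
  have hv0 : v 0 = 0 := by
    simp only [hv]
    rw [CTMC.expectedVisits_eq, if_neg hnot0, if_neg, add_zero]
    rw [phaseState_inj]; omega
  have hvrec : ∀ k, v (k + 1) = (if k = l then 1 else 0) +
      (v k * C.lam m + v (k + 2) * C.mu m) * ENNReal.ofReal ν⁻¹ := by
    intro k
    rw [hν]
    exact C.expectedVisits_phaseState j₀ hlam subset_rfl (mem_phaseSet_iff.2 ⟨k, rfl⟩)
  -- the Green function, extended by `0` to all states, solves the equations of `expectedVisits`
  let W : ClassMState N M j₀ → ℝ≥0∞ :=
    Function.extend (phaseState N j₀ m) (fun k => ENNReal.ofReal (ν * G k)) 0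
  have hWk : ∀ k, W (phaseState N j₀ m k) = ENNReal.ofReal (ν * G k) :=
    fun k => (phaseState_injective N j₀ m).extend_apply _ _ _
  have hW0 : ∀ x ∉ phaseSet N j₀ m, W x = 0 := by
    intro x hx
    by_cases h : ∃ k, phaseState N j₀ m k = x
    · obtain ⟨k, rfl⟩ := h
      rcases k with _ | k
      · rw [hWk, hG0, mul_zero, ENNReal.ofReal_zero]
      · exact absurd (mem_phaseSet_iff.2 ⟨k, rfl⟩) hx
    · exact Function.extend_apply' _ _ _ h
  have hle : ∀ k, v k ≤ ENNReal.ofReal (ν * G k) := by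
    intro k
    rw [← hWk]
    refine CTMC.expectedVisits_le _ _ _ W (fun x => ?_) _
    by_cases hx : x ∈ phaseSet N j₀ m
    · obtain ⟨k, rfl⟩ := mem_phaseSet_iff.1 hx
      have hG1 := hGnn k
      have hG2 := hGnn (k + 2)
      rw [if_pos hx, C.tsum_mul_jumpLaw j₀ hlam hW0, hWk, hWk, hWk, ← hν, hrec k,
        ← ENNReal.ofReal_coe_nnreal, ← ENNReal.ofReal_coe_nnreal,
        ← ENNReal.ofReal_mul (by positivity), ← ENNReal.ofReal_mul (by positivity),
        ← ENNReal.ofReal_add (by positivity) (by positivity),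
        ← ENNReal.ofReal_mul (by positivity), add_assoc, ENNReal.ofReal_add (by positivity)
        (by positivity)]
      refine add_le_add (le_of_eq ?_) (le_of_eq ?_)
      · simp only [phaseState_inj]
        split_ifs <;> simp
      · congr 1
        field_simp
    · rw [if_neg hx, if_neg, add_zero]
      · exact zero_le
      · rintro rfl
        exact hx (mem_phaseSet_iff.2 ⟨l, rfl⟩)
  have hvtop : ∀ k, v k ≠ ∞ := fun k => ne_top_of_le_ne_top ENNReal.ofReal_ne_top (hle k)
  have hfin : ∀ (k : ℕ) (c : ℝ≥0), v k * c ≠ ∞ :=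
    fun k c => ENNReal.mul_ne_top (hvtop k) ENNReal.coe_ne_top
  have hD : ν * G k - (v k).toReal = 0 := by
    refine eq_zero_of_recurrence (r := r) (R := f⁻¹) (l := l + 1)
      (K := ν * (Om * (1 - (r * f) ^ (l + 1))) / r ^ (l + 1))
      (D := fun k => ν * G k - (v k).toReal) hr0 ?_ ?_ ?_ ?_ ?_ k
    · rwa [← one_div, lt_div_iff₀ hf0]
    · simp [hG0, hv0]
    · intro k
      have hvr := congrArg ENNReal.toReal (hvrec k)
      rw [ENNReal.toReal_add, ENNReal.toReal_mul, ENNReal.toReal_add, ENNReal.toReal_mul,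
        ENNReal.toReal_mul, ENNReal.toReal_ofReal (by positivity), ENNReal.coe_toReal,
        ENNReal.coe_toReal] at hvr
      · have hite : (if k = l then (1 : ℝ≥0∞) else 0).toReal = if k + 1 = l + 1 then 1 else 0 := by
          simp only [add_left_inj]; split_ifs <;> simp
        rw [hite] at hvr
        have hG1 := hrec k
        set c : ℝ := if k + 1 = l + 1 then 1 else 0
        have hvr' : ν * (v (k + 1)).toReal = ν * c + (v k).toReal * C.lam m +
            (v (k + 2)).toReal * C.mu m := by
          rw [hvr]; field_simp; ring
        have hfμ : f * C.mu m ≠ 0 := (mul_pos hf0 hμ).ne'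
        -- multiplied by `f * μ`, the recurrence reads `f (μ D'' - ν D' + λ D) = 0`, because
        -- `μ r = λ f` and `ν f = λ f ^ 2 + μ`
        refine mul_left_cancel₀ hfμ ?_
        have hinv : f * f⁻¹ = 1 := mul_inv_cancel₀ hf0.ne'
        linear_combination (-(f * ν)) * hG1 + f * hvr' +
          (ν * G (k + 1) - (v (k + 1)).toReal) * (hf - f * hr) -
          C.mu m * (ν * G (k + 1) - (v (k + 1)).toReal) * hinv +
          (ν * G k - (v k).toReal) * (hr + C.mu m * r * hinv)
      · exact hfin _ _
      · exact hfin _ _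
      · split_ifs <;> simp
      · exact ENNReal.mul_ne_top (ENNReal.add_ne_top.2 ⟨hfin _ _, hfin _ _⟩) ENNReal.ofReal_ne_top
    · intro k
      exact sub_nonneg.2 (ENNReal.toReal_le_of_le_ofReal (mul_nonneg hpos.le (hGnn k)) (hle k))
    · intro k hk
      have h := ENNReal.toReal_nonneg (a := v k)
      have hGk : G k = Om * r ^ (k - (l + 1)) * (1 - (r * f) ^ (l + 1)) := greenWalk_of_le hk
      have hpow : r ^ k = r ^ (k - (l + 1)) * r ^ (l + 1) := by
        rw [← pow_add, Nat.sub_add_cancel hk]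
      have hK : ν * (Om * (1 - (r * f) ^ (l + 1))) / r ^ (l + 1) * r ^ k = ν * G k := by
        rw [hGk, hpow]; field_simp
      rw [hK]
      exact sub_le_self _ h
  rw [← sub_eq_zero.1 hD |>.symm, ENNReal.ofReal_toReal (hvtop k)]

/-! ### The characteristic roots -/

/-- `φ_m(α_m)` is a root of `λ_m x ^ 2 - (α_m + λ_m + μ_m) x + μ_m`. -/
theorem phi_quadratic {m : Fin (M + 1)} (hlam : 0 < C.lam m)
    (hdisc : 4 * (C.lam m : ℝ) * C.mu m < C.phaseRate m ^ 2) :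
    C.phaseRate m * C.phi m (C.alphaTot m) =
      C.lam m * C.phi m (C.alphaTot m) ^ 2 + C.mu m := by
  have hl : (0 : ℝ) < C.lam m := hlam
  have hs := Real.sq_sqrt (sub_pos.2 hdisc).le
  rw [phi, ← phaseRate]
  set s := √(C.phaseRate m ^ 2 - 4 * C.lam m * C.mu m)
  field_simp
  linear_combination -hs

/-- `φ_m(α_m)` lies below the midpoint of the two roots, so it is the smaller one. -/
theorem two_mul_phi_lt {m : Fin (M + 1)} (hlam : 0 < C.lam m)
    (hdisc : 4 * (C.lam m : ℝ) * C.mu m < C.phaseRate m ^ 2) :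
    2 * C.lam m * C.phi m (C.alphaTot m) < C.phaseRate m := by
  have hl : (0 : ℝ) < C.lam m := hlam
  have hs := Real.sqrt_pos.2 (sub_pos.2 hdisc)
  rw [phi, ← phaseRate, mul_div_cancel₀ _ (by positivity)]
  linarith

theorem phi_pos {m : Fin (M + 1)} (hlam : 0 < C.lam m) (hmu : 0 < C.mu m) :
    0 < C.phi m (C.alphaTot m) := by
  have hl : (0 : ℝ) < C.lam m := hlam
  have hμ : (0 : ℝ) < C.mu m := hmu
  rw [phi, ← phaseRate]
  refine div_pos (sub_pos.2 ?_) (by positivity)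
  rw [Real.sqrt_lt' (C.phaseRate_pos hlam)]
  have : 0 < 4 * (C.lam m : ℝ) * C.mu m := by positivity
  linarith

end ClassMRates

theorem theorem2 {N : Type*} [Finite N] {M : ℕ} (j₀ : ℕ) (C : ClassMRates N M)
    (hC : C.IsClassM j₀) (m : Fin (M + 1)) (hlam : 0 < C.lam m) (hmu : 0 < C.mu m)
    (l j : ℕ) (hl : j₀ + 1 ≤ l) (hj : j₀ + 1 ≤ j) :
    CTMC.expectedTime (C.rate j₀) (ClassMRates.phaseSet N j₀ m)
        (.rep m l (Nat.le_of_succ_le hl)) (.rep m j (Nat.le_of_succ_le hj)) ≠ ∞ ∧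
    (l ≤ j →
      (CTMC.expectedTime (C.rate j₀) (ClassMRates.phaseSet N j₀ m)
          (.rep m l (Nat.le_of_succ_le hl)) (.rep m j (Nat.le_of_succ_le hj))).toReal =
        C.Omega m * C.r m ^ (j - l) *
          (1 - (C.r m * C.phi m (C.alphaTot m)) ^ (l - j₀))) ∧
    (j ≤ l →
      (CTMC.expectedTime (C.rate j₀) (ClassMRates.phaseSet N j₀ m)
          (.rep m l (Nat.le_of_succ_le hl)) (.rep m j (Nat.le_of_succ_le hj))).toReal =
        C.Omega m * C.phi m (C.alphaTot m) ^ (l - j) *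
          (1 - (C.r m * C.phi m (C.alphaTot m)) ^ (j - j₀))) := by
  obtain ⟨a, rfl⟩ : ∃ a, l = j₀ + (a + 1) := ⟨l - (j₀ + 1), by omega⟩
  obtain ⟨b, rfl⟩ : ∃ b, j = j₀ + (b + 1) := ⟨j - (j₀ + 1), by omega⟩
  have hlam' : (0 : ℝ) < C.lam m := hlam
  have hmu' : (0 : ℝ) < C.mu m := hmu
  have hν := C.phaseRate_pos hlam
  have hdisc := ClassMRates.four_mul_lt_sq_phaseRate C hC hlam
  have hf := C.phi_quadratic hlam hdisc
  have hlt := C.two_mul_phi_lt hlam hdisc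
  have hf0 := C.phi_pos hlam hmu
  have hr_def : C.r m = C.lam m / C.mu m * C.phi m (C.alphaTot m) := by
    rw [ClassMRates.r, if_pos hmu, ClassMRates.rho]
  have hOmega : C.Omega m =
    C.r m / (C.lam m * (1 - C.r m * C.phi m (C.alphaTot m))) := rfl
  set f := C.phi m (C.alphaTot m)
  set r := C.r m
  have hr : C.mu m * r = C.lam m * f := by rw [hr_def]; field_simp
  have hr0 : 0 < r := by rw [hr_def]; positivity
  have hrf : r * f < 1 := by
    rw [← mul_lt_mul_iff_right₀ hmu', mul_one]
    nlinarith [mul_lt_mul_of_pos_right hlt hf0]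
  have hgreen : 0 ≤ greenWalk (C.Omega m) r f (a + 1) (b + 1) := by
    refine greenWalk_nonneg ?_ hr0.le hf0.le hrf.le _ _
    rw [hOmega]
    exact div_nonneg hr0.le (mul_nonneg hlam'.le (by linarith))
  have key : CTMC.expectedTime (C.rate j₀) (ClassMRates.phaseSet N j₀ m)
      (ClassMRates.phaseState N j₀ m (a + 1)) (ClassMRates.phaseState N j₀ m (b + 1)) =
      ENNReal.ofReal (greenWalk (C.Omega m) r f (a + 1) (b + 1)) := by
    rw [CTMC.expectedTime_eq _ (ClassMRates.mem_phaseSet_iff.2 ⟨a, rfl⟩),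
      C.expectedVisits_phaseSet hlam hmu hr0 hf0 hr hf hrf,
      C.lintegral_holdingLaw_phaseState j₀ hlam, ← hOmega,
      ← ENNReal.ofReal_mul (mul_nonneg hν.le hgreen)]
    congr 1
    field_simp
  change CTMC.expectedTime _ _ (ClassMRates.phaseState N j₀ m (a + 1))
      (ClassMRates.phaseState N j₀ m (b + 1)) ≠ ∞ ∧
    (_ → (CTMC.expectedTime _ _ (ClassMRates.phaseState N j₀ m (a + 1))
      (ClassMRates.phaseState N j₀ m (b + 1))).toReal = _) ∧
    (_ → (CTMC.expectedTime _ _ (ClassMRates.phaseState N j₀ m (a + 1))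
      (ClassMRates.phaseState N j₀ m (b + 1))).toReal = _)
  rw [key, ENNReal.toReal_ofReal hgreen]
  simp only [Nat.add_sub_add_left, Nat.add_sub_cancel_left]
  exact ⟨ENNReal.ofReal_ne_top, fun h => greenWalk_of_le (by omega),
    fun h => greenWalk_of_ge (by omega)⟩
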